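/- Let $q=p^{2t}$ range over the numbers with $p\equiv 3\pmod 4$ prime and $t\ge 1$ an integer. Let $\chi_4$ be a multiplicative character of order $4$ of the finite field $\mathbb{F}_q$ and $\varepsilon$ the trivial character (all multiplicative characters, including $\varepsilon$, are complex-valued and extended by $\chi(0)=0$). For multiplicative characters $A,B$ of $\mathbb{F}_q$ put $$\binom{A}{B}=\frac{B(-1)}{q}\sum_{x\in\mathbb{F}_q}A(x)\overline{B}(1-x),$$ and let $${}_3F_2\left(\begin{array}{ccc}A_0,&A_1,&A_2\\&B_1,&B_2\end{array}\Big|\;x\right)=\frac{q}{q-1}\sum_{\chi}\binom{A_0\chi}{\chi}\binom{A_1\chi}{B_1\chi}\binom{A_2\chi}{B_2\chi}\chi(x)$$ be Greene's hypergeometric function, where $\chi$ runs over all multiplicative characters of $\mathbb{F}_q$. Then $$\lim_{q\to\infty}{}_3F_2\left(\begin{array}{ccc}\chi_4,&\chi_4,&\chi_4^3\\&\varepsilon,&\varepsilon\end{array}\Big|\;1\right)=0,$$ that is, for every $\delta>0$ there is an $N$ such that, for all such $q=p^{2t}\ge N$ and every character $\chi_4$ of order $4$ of $\mathbb{F}_q$,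 this value has absolute value less than $\delta$. -/

import Mathlib

/-- The binomial coefficient `(A choose B) = B(-1)/q * J(A, B⁻¹)` of two multiplicative characters
of a finite field with `q` elements. A `MulChar F ℂ` vanishes at `0`, also when it is trivial. -/
noncomputable def charBinom {F : Type*} [Field F] [Fintype F] (A B : MulChar F ℂ) : ℂ :=
  B (-1) / (Fintype.card F : ℂ) * jacobiSum A B⁻¹

/-- Greene's finite field hypergeometric function `ₙ₊₁Fₙ(A₀, A₁, …, Aₙ; B₁, …, Bₙ | x)`. The lower
characters `B₁, …, Bₙ` are `B 0, …, B (n - 1)`, so that `A i.succ` is paired with `B i`; the outer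
sum runs over all multiplicative characters of `F`. -/
noncomputable def greeneHypergeometric {F : Type*} [Field F] [Fintype F] {n : ℕ}
    (A : Fin (n + 1) → MulChar F ℂ) (B : Fin n → MulChar F ℂ) (x : F) : ℂ :=
  haveI : Fintype (MulChar F ℂ) := Fintype.ofFinite (MulChar F ℂ)
  (Fintype.card F : ℂ) / ((Fintype.card F : ℂ) - 1) *
    ∑ χ : MulChar F ℂ,
      charBinom (A 0 * χ) χ * (∏ i : Fin n, charBinom (A i.succ * χ) (B i * χ)) * χ x

/-!
Greene's function is normalised so that every binomial coefficient of characters is a Jacobi sum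
divided by `q`. A Jacobi sum `J(A, B)` has absolute value at most `√q` unless `A` and `B` are both
trivial (`norm_jacobiSum_le`): it is `√q` when `A`, `B` and `A * B` are nontrivial, and a sign
otherwise. In the binomial coefficient attached to `χ₄ ^ k * χ` over `χ` the Jacobi sum is
`J(χ₄ ^ k * χ, χ⁻¹)`, and its two arguments are never both trivial, because their product
`χ₄ ^ k` is nontrivial for `k = 1, 3`. So each of the `q - 1` terms of the outer sum is a
product of three factors of size at most `1 / √q`, and the whole value is at most
`q / (q - 1) * (q - 1) * q ^ (-3 / 2) = 1 / √q` (`norm_greeneHypergeometric_le`), which tends to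
`0` uniformly in the character.
-/

theorem MulChar.norm_apply_neg_one {R : Type*} [CommRing R] (χ : MulChar R ℂ) :
    ‖χ (-1)‖ = 1 := by
  have h : χ (-1) ^ 2 = 1 := by rw [← map_pow, neg_one_sq, map_one]
  exact Complex.norm_eq_one_of_pow_eq_one h two_ne_zero

section FiniteField

variable {F : Type*} [Field F] [Fintype F]

theorem star_jacobiSum (χ φ : MulChar F ℂ) :
    star (jacobiSum χ φ) = jacobiSum χ⁻¹ φ⁻¹ := by
  simp only [jacobiSum, star_sum, star_mul', MulChar.star_apply']

theorem norm_jacobiSum_of_ne_one {χ φ : MulChar F ℂ} (hχ : χ ≠ 1) (hφ : φ ≠ 1)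
    (hχφ : χ * φ ≠ 1) : ‖jacobiSum χ φ‖ = √(Fintype.card F) := by
  have hchar : ringChar ℂ ≠ ringChar F := by
    rw [ringChar.eq_zero]
    exact (CharP.ringChar_ne_zero_of_finite F).symm
  have h := congrArg norm (jacobiSum_mul_jacobiSum_inv hchar hχ hφ hχφ)
  rw [← star_jacobiSum, norm_mul, norm_star, Complex.norm_natCast] at h
  rw [← h, Real.sqrt_mul_self (norm_nonneg _)]

theorem norm_jacobiSum_le {χ φ : MulChar F ℂ} (h : χ ≠ 1 ∨ φ ≠ 1) :
    ‖jacobiSum χ φ‖ ≤ √(Fintype.card F) := by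
  have hq : 1 ≤ √(Fintype.card F : ℝ) :=
    Real.one_le_sqrt.mpr (mod_cast Fintype.card_pos)
  by_cases hχ : χ = 1
  · rw [hχ, jacobiSum_one_nontrivial (h.resolve_left (not_not.mpr hχ))]
    simpa using hq
  by_cases hφ : φ = 1
  · rw [hφ, jacobiSum_comm, jacobiSum_one_nontrivial hχ]
    simpa using hq
  by_cases hχφ : χ * φ = 1
  · rw [eq_inv_of_mul_eq_one_right hχφ, jacobiSum_nontrivial_inv hχ, norm_neg,
      MulChar.norm_apply_neg_one]
    exact hq
  · exact (norm_jacobiSum_of_ne_one hχ hφ hχφ).le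

theorem norm_charBinom_mul_self_le {A : MulChar F ℂ} (hA : A ≠ 1) (χ : MulChar F ℂ) :
    ‖charBinom (A * χ) χ‖ ≤ 1 / √(Fintype.card F) := by
  have h : A * χ ≠ 1 ∨ χ⁻¹ ≠ 1 := by
    by_contra! h
    rw [inv_eq_one] at h
    exact hA (by simpa [h.2] using h.1)
  rw [charBinom, norm_mul, norm_div, MulChar.norm_apply_neg_one, Complex.norm_natCast]
  calc 1 / (Fintype.card F : ℝ) * ‖jacobiSum (A * χ) χ⁻¹‖
      ≤ 1 / (Fintype.card F : ℝ) * √(Fintype.card F) := by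
        gcongr
        exact norm_jacobiSum_le h
    _ = 1 / √(Fintype.card F) := by rw [one_div_mul_eq_div, Real.sqrt_div_self, one_div]

/-- The triangle inequality for the outer sum; the factor `q - 1` in the denominator cancels
against the number of multiplicative characters. -/
theorem norm_greeneHypergeometric_le {n : ℕ} {A : Fin (n + 1) → MulChar F ℂ}
    (hA : ∀ i, A i ≠ 1) :
    ‖greeneHypergeometric A (fun _ : Fin n ↦ 1) (1 : F)‖ ≤
      Fintype.card F * (1 / √(Fintype.card F)) ^ (n + 1) := by
  let _ : Fintype (MulChar F ℂ) := Fintype.ofFinite (MulChar F ℂ)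
  have hq : (1 : ℝ) < Fintype.card F := mod_cast Fintype.one_lt_card
  have hcard : (Fintype.card (MulChar F ℂ) : ℝ) = Fintype.card F - 1 := by
    rw [← Nat.card_eq_fintype_card, MulChar.card_eq_card_units_of_hasEnoughRootsOfUnity F ℂ,
      Nat.card_units, Nat.card_eq_fintype_card, Nat.cast_pred Fintype.card_pos]
  have hterm (χ : MulChar F ℂ) :
      ‖charBinom (A 0 * χ) χ * (∏ i : Fin n, charBinom (A i.succ * χ) (1 * χ)) * χ 1‖ ≤
        (1 / √(Fintype.card F)) ^ (n + 1) := by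
    rw [map_one, mul_one, one_mul, norm_mul, norm_prod, pow_succ']
    gcongr
    · exact norm_charBinom_mul_self_le (hA 0) χ
    · refine (Finset.prod_le_prod (fun i _ ↦ norm_nonneg _) fun i _ ↦
        norm_charBinom_mul_self_le (hA i.succ) χ).trans_eq ?_
      rw [Finset.prod_const, Finset.card_univ, Fintype.card_fin]
  have hsum := norm_sum_le_of_le Finset.univ fun χ _ ↦ hterm χ
  rw [Finset.sum_const, Finset.card_univ, nsmul_eq_mul, hcard] at hsum
  have hfac : ‖(Fintype.card F : ℂ) / ((Fintype.card F : ℂ) - 1)‖ =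
      (Fintype.card F : ℝ) / (Fintype.card F - 1) := by
    have : (Fintype.card F : ℂ) / ((Fintype.card F : ℂ) - 1) =
        (((Fintype.card F : ℝ) / (Fintype.card F - 1) : ℝ) : ℂ) := by push_cast; rfl
    rw [this, Complex.norm_of_nonneg (div_nonneg (by linarith) (by linarith))]
  rw [greeneHypergeometric, norm_mul, hfac]
  refine (mul_le_mul_of_nonneg_left hsum (div_nonneg (by linarith) (by linarith))).trans_eq ?_
  rw [← mul_assoc, div_mul_cancel₀ _ (by linarith)]

end FiniteField

theorem corollary1 :
    ∀ δ : ℝ, 0 < δ → ∃ N : ℕ, ∀ p t : ℕ, p.Prime → p % 4 = 3 → 0 < t → N ≤ p ^ (2 * t) →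
      ∀ (F : Type*) [Field F] [Fintype F], Fintype.card F = p ^ (2 * t) →
        ∀ χ₄ : MulChar F ℂ, orderOf χ₄ = 4 →
          ‖greeneHypergeometric ![χ₄, χ₄, χ₄ ^ 3] ![1, 1] (1 : F)‖ < δ := by
  intro δ hδ
  obtain ⟨N, hN⟩ := exists_nat_gt ((1 / δ) ^ 2)
  refine ⟨N, fun p t _ _ _ hle F _ _ hF χ₄ h₄ ↦ ?_⟩
  have h1 : χ₄ ≠ 1 := by
    rintro rfl
    simp at h₄
  have h3 : χ₄ ^ 3 ≠ 1 := pow_ne_one_of_lt_orderOf (by norm_num) (by omega)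
  have hA : ∀ i, ![χ₄, χ₄, χ₄ ^ 3] i ≠ 1 := by
    intro i
    fin_cases i
    exacts [h1, h1, h3]
  have hB : (![1, 1] : Fin 2 → MulChar F ℂ) = fun _ ↦ 1 := by
    ext i : 1
    fin_cases i <;> rfl
  have hq : (0 : ℝ) < Fintype.card F := mod_cast Fintype.card_pos
  have hs : 0 < √(Fintype.card F : ℝ) := Real.sqrt_pos.mpr hq
  have hbig : 1 / δ < √(Fintype.card F) := by
    refine Real.lt_sqrt_of_sq_lt (hN.trans_le ?_)
    rw [hF]
    exact_mod_cast hle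
  rw [hB]
  calc ‖greeneHypergeometric ![χ₄, χ₄, χ₄ ^ 3] (fun _ ↦ 1) (1 : F)‖
      ≤ Fintype.card F * (1 / √(Fintype.card F)) ^ 3 := norm_greeneHypergeometric_le hA
    _ = 1 / √(Fintype.card F) := by
        rw [one_div, inv_pow, pow_succ, Real.sq_sqrt hq.le]
        field_simp
    _ < δ := (one_div_lt hδ hs).mp hbig
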